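/- Let $p$ be a prime, $S$ a finite $p$-group and $\mathcal{F}$ an Alperin fusion system on $S$; that is, there are subgroups $S=P_1,P_2,\dots,P_r$ of $S$ and finite groups $L_1,\dots,L_r$ such that, for each $i$, $N_S(P_i)$ is (identified with) a Sylow $p$-subgroup of $L_i$, $P_i=O_p(L_i)$, $C_{L_i}(P_i)=Z(P_i)$, $L_i/P_i\cong \mathrm{Out}_{\mathcal{F}}(P_i)$ and $\mathcal{F}_{N_S(P_i)}(L_i)\subseteq\mathcal{F}$, and such that $\mathcal{F}$ is the smallest fusion system on $S$ containing all $\mathcal{F}_{N_S(P_i)}(L_i)$. For each $i$ choose finitely many subgroups (at least one) of $L_i$, each containing $N_S(P_i)$, which together generate $L_i$. List all the chosen subgroups as $K_1,\dots,K_n$, starting with one of those chosen in $L_1$, so that $S\le K_1$; for each $j$ write $Q_j$ for the subgroup $P_i$ belonging to the group $L_i$ in which $K_j$ was chosen. Let $$G=K_1\underset{N_S(Q_2)}{*}K_2\underset{N_S(Q_3)}{*}\cdots\underset{N_S(Q_n)}{*}K_n$$ be the iterated amalgam, i.e. the free product of $K_1,\dots,K_n$ modulo the identification, for each $j$, of the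 subgroup $N_S(Q_j)\le K_j$ with $N_S(Q_j)\le S\le K_1$. For each $j$ let $H_j$ be a $p'$-subgroup of $K_j$ (a subgroup of order prime to $p$), and let $t=\operatorname{lcm}\{[K_j:H_j] : 1\le j\le n\}$. Then there is a group homomorphism $\phi:G\to S_t$ to the symmetric group on $t$ letters whose kernel is a free group. In particular $G$ is virtually free, i.e. it has a free subgroup of finite index. -/

import Mathlib

universe u v

/-- A fusion system on a group `S` (of interest when `S` is a finite `p`-group): the objects are the
subgroups of `S`, the morphisms `P → Q` are injective homomorphisms, among them all those induced by
conjugation in `S`, closed under composition, and every morphism is an isomorphism of the category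
followed by an inclusion. (Identities are conjugations by `1`.) -/
structure FusionSystem (S : Type u) [Group S] where
  Hom : ∀ P Q : Subgroup S, Set (P →* Q)
  injective : ∀ {P Q : Subgroup S} {φ : P →* Q}, φ ∈ Hom P Q → Function.Injective φ
  conj_mem : ∀ {P Q : Subgroup S} (g : S) (φ : P →* Q),
    (∀ x : P, (φ x : S) = g * x * g⁻¹) → φ ∈ Hom P Q
  comp_mem : ∀ {P Q R : Subgroup S} {ψ : Q →* R} {φ : P →* Q},
    ψ ∈ Hom Q R → φ ∈ Hom P Q → ψ.comp φ ∈ Hom P R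
  factor : ∀ {P Q : Subgroup S} {φ : P →* Q}, φ ∈ Hom P Q →
    ∃ (R : Subgroup S) (h : R ≤ Q) (e : P ≃* R),
      e.toMonoidHom ∈ Hom P R ∧ e.symm.toMonoidHom ∈ Hom R P ∧
        φ = (Subgroup.inclusion h).comp e.toMonoidHom

namespace FusionSystem

variable {S : Type u} [Group S]

/-- `Aut_F(P)`, as a subgroup of `Aut(P)`. -/
def aut (F : FusionSystem S) (P : Subgroup S) : Subgroup (MulAut P) where
  carrier := {α | MulEquiv.toMonoidHom α ∈ F.Hom P P}
  mul_mem' := fun ha hb => F.comp_mem ha hb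
  one_mem' := F.conj_mem 1 _ (fun x => by simp)
  inv_mem' := by
    intro α hα
    obtain ⟨R, h, e, -, he, hφ⟩ := F.factor hα
    have hR : R = P := by
      refine le_antisymm h fun x hx => ?_
      obtain ⟨y, hy⟩ := α.surjective ⟨x, hx⟩
      have h1 := DFunLike.congr_fun hφ y
      change α y = Subgroup.inclusion h (e y) at h1
      rw [hy] at h1
      have h2 := congrArg Subtype.val h1
      change x = (e y : S) at h2
      rw [h2]
      exact (e y).2
    subst hR
    have hαe : α = e := by
      ext y
      exact congrArg Subtype.val (DFunLike.congr_fun hφ y)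
    rw [hαe]
    exact he

/-- `Inn(P)`, as a subgroup of `Aut_F(P)`. -/
def inn (F : FusionSystem S) (P : Subgroup S) : Subgroup (F.aut P) :=
  (MulAut.conj : P →* MulAut P).range.subgroupOf (F.aut P)

instance inn_normal (F : FusionSystem S) (P : Subgroup S) : (F.inn P).Normal := by
  constructor
  rintro ⟨a, ha⟩ ⟨g, hg⟩ ⟨b, hb⟩
  refine ⟨b g, ?_⟩
  change MulAut.conj g = a at hg
  subst hg
  change MulAut.conj (b g) = b * MulAut.conj g * b⁻¹
  ext x
  simp

/-- `Out_F(P) = Aut_F(P) / Inn(P)`. -/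
abbrev Out (F : FusionSystem S) (P : Subgroup S) : Type u := F.aut P ⧸ F.inn P

/-- For a homomorphism `ι : N → L` identifying the subgroup `N ≤ S` with a subgroup of `L`, the
morphisms `A → B` of the fusion system `F_N(L)` on `N`, for `A, B ≤ N`: the homomorphisms
induced by conjugation with an element of `L`. -/
def conjHoms {L : Type v} [Group L] {N : Subgroup S} (ι : N →* L) (A B : Subgroup S) :
    Set (A →* B) :=
  {φ | ∃ (hA : A ≤ N) (hB : B ≤ N) (g : L), ∀ x : A,
    ι (Subgroup.inclusion hB (φ x)) = g * ι (Subgroup.inclusion hA x) * g⁻¹}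

end FusionSystem

/-- `O_p(L)`, the subgroup generated by all normal `p`-subgroups of `L`. For finite `L` it is the
largest normal `p`-subgroup. -/
def opRadical (p : ℕ) (L : Type v) [Group L] : Subgroup L :=
  sSup {N : Subgroup L | N.Normal ∧ IsPGroup p N}

instance opRadical_normal (p : ℕ) (L : Type v) [Group L] : (opRadical p L).Normal :=
  Subgroup.sSup_normal _ fun _ h => h.1

/-- The subgroups `P 0, …, P r` of `S` and the finite groups `L 0, …, L r`, together with
identifications `ι i` of `N_S(P i)` with a Sylow `p`-subgroup of `L i`, exhibit `F` as an Alperin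
fusion system. -/
structure IsAlperinFamily (p : ℕ) {S : Type u} [Group S] (F : FusionSystem S) {r : ℕ}
    (P : Fin (r + 1) → Subgroup S) (L : Fin (r + 1) → Type v) [∀ i, Group (L i)]
    (ι : ∀ i, Subgroup.normalizer (P i : Set S) →* L i) : Prop where
  P_zero : P 0 = ⊤
  finite : ∀ i, Finite (L i)
  ι_injective : ∀ i, Function.Injective (ι i)
  /-- `N_S(P i)` is a Sylow `p`-subgroup of `L i`. -/
  sylow : ∀ i, ∃ T : Sylow p (L i), (T : Subgroup (L i)) = (ι i).range
  /-- `P i = O_p(L i)` under the identification `ι i`. -/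
  radical : ∀ i, ((P i).subgroupOf (Subgroup.normalizer (P i : Set S))).map (ι i) =
    opRadical p (L i)
  /-- `C_{L i}(P i) = Z(P i)`. -/
  centric : ∀ i, Subgroup.centralizer (opRadical p (L i) : Set (L i)) =
    (Subgroup.center (opRadical p (L i))).map (opRadical p (L i)).subtype
  /-- `L i / P i ≅ Out_F(P i)`. -/
  out : ∀ i, Nonempty ((L i ⧸ opRadical p (L i)) ≃* F.Out (P i))
  /-- The fusion system of `L i` on `N_S(P i)` is contained in `F`. -/
  le : ∀ i A B, FusionSystem.conjHoms (ι i) A B ⊆ F.Hom A B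
  /-- `F` is generated by these, that is, it is the smallest fusion system containing them. -/
  generated : ∀ F' : FusionSystem S, (∀ i A B, FusionSystem.conjHoms (ι i) A B ⊆ F'.Hom A B) →
    ∀ A B, F.Hom A B ⊆ F'.Hom A B

section Amalgam

variable {S : Type u} [Group S] {r : ℕ} {P : Fin (r + 1) → Subgroup S}
  {L : Fin (r + 1) → Type v} [∀ i, Group (L i)]
  {ι : ∀ i, Subgroup.normalizer (P i : Set S) →* L i}
  {m : Fin (r + 1) → ℕ} {K : ∀ i, Fin (m i + 1) → Subgroup (L i)}

/-- `N_S(P i)` as a subgroup of `K i k`. -/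
def vertexHom (hK : ∀ i k, (ι i).range ≤ K i k) (i : Fin (r + 1)) (k : Fin (m i + 1)) :
    Subgroup.normalizer (P i : Set S) →* K i k :=
  (ι i).codRestrict (K i k) fun u => hK i k ⟨u, rfl⟩

/-- `S = N_S(P 0)` as a subgroup of the first group `K 0 0`. -/
def rootHom (h0 : P 0 = ⊤) (hK : ∀ i k, (ι i).range ≤ K i k) : S →* K 0 0 :=
  (vertexHom hK 0 0).comp <|
    (MonoidHom.id S).codRestrict (Subgroup.normalizer (P 0 : Set S)) fun u => by
      have : (P 0).Normal := by rw [h0]; infer_instance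
      rw [Subgroup.normalizer_eq_top]
      exact Subgroup.mem_top _

/-- The relators of the amalgam: each `u ∈ N_S(P i)`, taken in `K i k`, is identified with `u`,
taken in `S ≤ K 0 0`. -/
def amalgamRelators (h0 : P 0 = ⊤) (hK : ∀ i k, (ι i).range ≤ K i k) :
    Set (Monoid.CoprodI fun j : (i : Fin (r + 1)) × Fin (m i + 1) => K j.1 j.2) :=
  {w | ∃ (i : Fin (r + 1)) (k : Fin (m i + 1)) (u : Subgroup.normalizer (P i : Set S)),
    w = Monoid.CoprodI.of (M := fun j : (i : Fin (r + 1)) × Fin (m i + 1) => K j.1 j.2)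
          (i := ⟨i, k⟩) (vertexHom hK i k u) *
        (Monoid.CoprodI.of (M := fun j : (i : Fin (r + 1)) × Fin (m i + 1) => K j.1 j.2)
          (i := ⟨0, 0⟩) (rootHom h0 hK u))⁻¹}

/-- The iterated amalgam of all the groups `K i k`, each one amalgamated with `K 0 0 ≥ S` along
`N_S(P i)`: the free product of the `K i k` modulo the identifications of the two copies of
`N_S(P i)`. -/
abbrev Amalgam (h0 : P 0 = ⊤) (hK : ∀ i k, (ι i).range ≤ K i k) : Type v :=
  (Monoid.CoprodI fun j : (i : Fin (r + 1)) × Fin (m i + 1) => K j.1 j.2) ⧸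
    Subgroup.normalClosure (amalgamRelators h0 hK)

end Amalgam

/-! Each `K j` acts on `t` points as copies of `K j / H j`. Point stabilizers are `p'`-groups, so
the `p`-group `N_S(Q j)` acts freely; any two free actions of it on `t` points are conjugate
(`exists_perm_conj_of_free`), so conjugating the actions makes them agree on the amalgamated
subgroups and gives `φ`. The action of `K j` is faithful: its kernel, the core of `H j`, is a normal
`p'`-subgroup, and such a subgroup centralizes the self-centralizing `O_p`
(`eq_bot_of_normal_of_coprime`).

So `ker φ` meets every conjugate of every `K j` trivially. Instead of letting it act on the
Bass–Serre tree, take the action groupoid of `G` on `Q = G / ker φ`, where each `K j` acts freely.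
It is a free groupoid (`exists_isFreeGroupoid`), and `ker φ` is a vertex group of it. Freeness is
tested on functors to a group `X`, which are the homomorphisms `G → (Q → X) ⋊ G` over `G`; the
universal property of the amalgam constructs these. -/

section FreeSubgroup

/-! ### Freely acting subgroups of an amalgam are free -/

open CategoryTheory CategoryTheory.ActionCategory

/-- Orbit representatives for a subgroup. -/
theorem Subgroup.exists_orbit_representative {G : Type*} [Group G] {Q : Type*} [MulAction G Q]
    (N : Subgroup G) :
    ∃ rep : Q → Q, (∀ q, ∃ n ∈ N, n • rep q = q) ∧ ∀ n ∈ N, ∀ q, rep (n • q) = rep q := by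
  refine ⟨fun q => Quotient.out (Quotient.mk (MulAction.orbitRel N Q) q), fun q => ?_,
    fun n hn q => ?_⟩
  · obtain ⟨n, hn⟩ := (MulAction.orbitRel N Q).symm (Quotient.mk_out (s := MulAction.orbitRel N Q) q)
    exact ⟨n, n.2, hn⟩
  · exact congrArg Quotient.out (Quotient.sound (s := MulAction.orbitRel N Q) ⟨⟨n, hn⟩, rfl⟩)

/-- Compatible orbit representatives for a subgroup and a larger one. -/
theorem Subgroup.exists_orbit_representatives_of_le {G : Type*} [Group G] {Q : Type*}
    [MulAction G Q] {N K : Subgroup G} (h : N ≤ K) :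
    ∃ rep base : Q → Q, (∀ q, ∃ n ∈ N, n • rep q = q) ∧ (∀ n ∈ N, ∀ q, rep (n • q) = rep q) ∧
      (∀ q, ∃ k ∈ K, k • base q = q) ∧ (∀ k ∈ K, ∀ q, base (k • q) = base q) ∧
        ∀ q, rep (base q) = base q := by
  obtain ⟨rep, h1, h2⟩ := N.exists_orbit_representative (Q := Q)
  obtain ⟨base, h3, h4⟩ := K.exists_orbit_representative (Q := Q)
  refine ⟨rep, fun q => rep (base q), h1, h2, fun q => ?_, fun k hk q => ?_, fun q => ?_⟩
  · obtain ⟨k, hk, hkq⟩ := h3 q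
    obtain ⟨n, hn, hnq⟩ := h1 (base q)
    exact ⟨k * n, K.mul_mem hk (h hn), by rw [mul_smul, hnq, hkq]⟩
  · exact congrArg rep (h4 k hk q)
  · obtain ⟨n, hn, hnq⟩ := h1 (base q)
    exact (h2 n hn _).symm.trans (congrArg rep hnq)

/-- The coboundary of a function on a `G`-set, as a section of the wreath product over a subgroup
of `G`. -/
def coboundaryHom {G : Type*} [Group G] {Q : Type*} [MulAction G Q] {X : Type*} [Group X]
    (K : Subgroup G) (d : Q → X) : K →* (Q → X) ⋊[mulAutArrow] G where
  toFun k := ⟨fun q => d q * (d ((k : G)⁻¹ • q))⁻¹, k⟩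
  map_one' := by
    ext q
    · simp
    · rfl
  map_mul' k l := by
    ext q
    · change _ = (d q * _) * (d ((k : G)⁻¹ • q) * (d ((l : G)⁻¹ • (k : G)⁻¹ • q))⁻¹)
      simp [mul_smul]
    · rfl

/-- A group isomorphic to a vertex group of a connected free groupoid is free. -/
theorem IsFreeGroupoid.isFreeGroup_of_end_mulEquiv {C : Type v} [Groupoid.{v} C] [IsConnected C]
    [IsFreeGroupoid C] (r : C) {M : Type v} [Group M] (e : End r ≃* M) : IsFreeGroup M :=
  IsFreeGroup.ofMulEquiv e

/-- The value of a functor on an arrow of the action groupoid, in terms of the curried functor. -/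
theorem curry_left_eq_map {G : Type*} [Group G] {Q : Type*} [MulAction G Q] {X : Type*} [Group X]
    (E : ActionCategory G Q ⥤ SingleObj X) {a b : ActionCategory G Q} (f : a ⟶ b) :
    E.map f = (curry E f.val).left b.back :=
  ActionCategory.cases (P := fun _ b f => E.map f = (curry E f.val).left b.back)
    (fun _ _ => rfl) f

/-- A family of subgroups of `G`, each amalgamated with the member `K root` along `N j`, exhibits
`G` as their amalgam: it generates `G`, and compatible homomorphisms extend to `G`. -/
structure IsStarAmalgam {G : Type v} [Group G] {J : Type} (root : J) (K N : J → Subgroup G) :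
    Prop where
  le : ∀ j, N j ≤ K j
  le_root : ∀ j, N j ≤ K root
  root_eq_bot : N root = ⊥
  iSup_eq_top : ⨆ j, K j = ⊤
  lift : ∀ {X : Type v} [Group X] (ψ : ∀ j, K j →* X),
    (∀ j x (hx : x ∈ N j), ψ j ⟨x, le j hx⟩ = ψ root ⟨x, le_root j hx⟩) →
      ∃ Ψ : G →* X, ∀ j (x : K j), Ψ x = ψ j x

namespace IsStarAmalgam

variable {G : Type v} [Group G] {J : Type} {root : J} {K N : J → Subgroup G}

/-- Two homomorphisms into the wreath product which agree on a generating set of arrows of the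
action groupoid agree. -/
theorem hom_ext_of_arrows (hG : IsStarAmalgam root K N) {Q : Type*} [MulAction G Q]
    {rep base : J → Q → Q}
    (hrep : ∀ j q, ∃ n ∈ N j, n • rep j q = q)
    (hrep' : ∀ j, ∀ n ∈ N j, ∀ q, rep j (n • q) = rep j q)
    (hbase : ∀ j q, ∃ k ∈ K j, k • base j q = q)
    (hbase' : ∀ j, ∀ k ∈ K j, ∀ q, base j (k • q) = base j q)
    {X : Type*} [Group X] {A B : G →* (Q → X) ⋊[mulAutArrow] G}
    (hA : ∀ g, (A g).right = g) (hB : ∀ g, (B g).right = g)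
    (h : ∀ j q, rep j q = q → ∀ k ∈ K j, k • base j q = q → (A k).left q = (B k).left q) :
    A = B := by
  have hmul : ∀ {C : G →* (Q → X) ⋊[mulAutArrow] G}, (∀ g, (C g).right = g) → ∀ g g' q,
      (C (g * g')).left q = (C g).left q * (C g').left (g⁻¹ • q) := by
    intro C hC g g' q
    rw [map_mul, SemidirectProduct.mul_left, hC]
    rfl
  -- Every arrow inside a `K j`-orbit is a quotient of two arrows issuing from its base point.
  have key : ∀ j, (∀ q, ∀ k ∈ K j, k • base j q = q → (A k).left q = (B k).left q) →
      ∀ k ∈ K j, ∀ q, (A k).left q = (B k).left q := by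
    intro j hj k hk q
    obtain ⟨l, hl, hlq⟩ := hbase j q
    have h1 := hj q l hl hlq
    have h2 := hj (k⁻¹ • q) (k⁻¹ * l) ((K j).mul_mem ((K j).inv_mem hk) hl)
      (by rw [hbase' j _ ((K j).inv_mem hk), mul_smul, hlq])
    have h3 : l = k * (k⁻¹ * l) := by group
    rw [h3, hmul hA, hmul hB, h2] at h1
    exact mul_right_cancel h1
  have hroot : ∀ k ∈ K root, ∀ q, (A k).left q = (B k).left q := by
    refine key root fun q k hk hkq => h root q ?_ k hk hkq
    obtain ⟨n, hn, hnq⟩ := hrep root q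
    rw [hG.root_eq_bot, Subgroup.mem_bot] at hn
    rwa [hn, one_smul] at hnq
  -- Factor `base j q ⟶ q` through `rep j q`: the second factor comes from `N j ≤ K root`, where
  -- agreement is already known.
  have hall : ∀ j, ∀ k ∈ K j, ∀ q, (A k).left q = (B k).left q := by
    refine fun j => key j fun q k hk hkq => ?_
    obtain ⟨n, hn, hnq⟩ := hrep j q
    have hb : base j (rep j q) = base j q := by
      conv_rhs => rw [← hnq, hbase' j n (hG.le j hn)]
    have hn' : rep j q = n⁻¹ • q := by rw [eq_inv_smul_iff, hnq]
    have hr : rep j (rep j q) = rep j q := by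
      conv_rhs => rw [← hnq, hrep' j n hn]
    have h1 := h j (rep j q) hr (n⁻¹ * k) ((K j).mul_mem ((K j).inv_mem (hG.le j hn)) hk)
      (by rw [hb, mul_smul, hkq, hn'])
    have h3 : k = n * (n⁻¹ * k) := by group
    rw [h3, hmul hA, hmul hB, hroot n (hG.le_root j hn), ← hn', h1]
  have hle : ⨆ j, K j ≤ A.eqLocus B := iSup_le fun j k hk =>
    SemidirectProduct.ext (funext (hall j k hk)) ((hA k).trans (hB k).symm)
  rw [hG.iSup_eq_top] at hle
  exact MonoidHom.ext fun g => hle (Subgroup.mem_top g)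

/-- Labels on the arrows `base j q ⟶ q`, for the representatives `q`, extend to a homomorphism
into the wreath product. -/
theorem exists_hom_of_labels (hG : IsStarAmalgam root K N) {Q : Type v} [MulAction G Q]
    {rep base : J → Q → Q}
    (hrep : ∀ j q, ∃ n ∈ N j, n • rep j q = q)
    (hrep' : ∀ j, ∀ n ∈ N j, ∀ q, rep j (n • q) = rep j q)
    (hbase' : ∀ j, ∀ k ∈ K j, ∀ q, base j (k • q) = base j q)
    (hrb : ∀ j q, rep j (base j q) = base j q)
    (hbb : ∀ j q, base j (base j q) = base j q)
    {X : Type v} [Group X] (y : J → Q → X) (hy : ∀ j q, base j q = q → y j q = 1) :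
    ∃ Ψ : G →* (Q → X) ⋊[mulAutArrow] G, (∀ g, (Ψ g).right = g) ∧
      ∀ j q, rep j q = q → ∀ k ∈ K j, k • base j q = q → (Ψ k).left q = y j q := by
  have hrepr : ∀ q, rep root q = q := by
    intro q
    obtain ⟨n, hn, hnq⟩ := hrep root q
    rw [hG.root_eq_bot, Subgroup.mem_bot] at hn
    rwa [hn, one_smul] at hnq
  -- The coboundaries of `d j` and `d root` agree on `N j` as soon as `(d root)⁻¹ * d j` is `N
  -- j`-invariant. `e j` is that invariant factor, chosen so that `d j q * (d j (base j q))⁻¹ = y j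
  -- q` at representatives.
  let e : J → Q → X := fun j q =>
    (y root (rep j q))⁻¹ * y j (rep j q) * y root (base j q)
  let d : J → Q → X := fun j q => y root q * e j q
  have he : ∀ j, ∀ n ∈ N j, ∀ q, e j (n • q) = e j q := by
    intro j n hn q
    simp only [e, hrep' j n hn, hbase' j n (hG.le j hn)]
  have hdroot : ∀ q, d root q = y root q := by
    intro q
    simp [d, e, hrepr, hy root _ (hbb root q)]
  obtain ⟨Ψ, hΨ⟩ := hG.lift (fun j => coboundaryHom (K j) (d j)) (by
    intro j n hn
    refine SemidirectProduct.ext (funext fun q => ?_) rfl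
    change d j q * (d j (n⁻¹ • q))⁻¹ = d root q * (d root (n⁻¹ • q))⁻¹
    rw [hdroot, hdroot]
    simp only [d, he j _ ((N j).inv_mem hn)]
    group)
  refine ⟨Ψ, fun g => ?_, fun j q hq k hk hkq => ?_⟩
  · have hle : ⨆ j, K j ≤ (SemidirectProduct.rightHom.comp Ψ).eqLocus (MonoidHom.id G) :=
      iSup_le fun j k hk => congrArg SemidirectProduct.right (hΨ j ⟨k, hk⟩)
    rw [hG.iSup_eq_top] at hle
    exact hle (Subgroup.mem_top g)
  · have h1 : k⁻¹ • q = base j q := by rw [inv_smul_eq_iff, hkq]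
    have h2 : (Ψ k).left q = d j q * (d j (k⁻¹ • q))⁻¹ :=
      congrFun (congrArg SemidirectProduct.left (hΨ j ⟨k, hk⟩)) q
    rw [h2, h1]
    simp only [d, e, hq, hrb, hbb, hy j _ (hbb j q)]
    group

/-- The action groupoid of an amalgam is free if the amalgamated groups act freely. -/
theorem exists_isFreeGroupoid (hG : IsStarAmalgam root K N) {Q : Type v} [MulAction G Q]
    (hfree : ∀ j, ∀ k ∈ K j, ∀ q : Q, k • q = q → k = 1) :
    Nonempty (IsFreeGroupoid (ActionCategory G Q)) := by
  classical
  choose rep base hrep hrep' hbase hbase' hrb using fun j =>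
    Subgroup.exists_orbit_representatives_of_le (Q := Q) (hG.le j)
  have hbb : ∀ j q, base j (base j q) = base j q := by
    intro j q
    obtain ⟨k, hk, hkq⟩ := hbase j q
    conv_rhs => rw [← hkq, hbase' j k hk]
  choose κ hκ hκq using hbase
  refine ⟨{
    -- One generator for each `N j`-orbit representative other than the base point of its `K
    -- j`-orbit; at the base point the arrow is an identity.
    quiverGenerators := ⟨fun a b => ULift.{v} { j : J //
      rep j b.back = b.back ∧ base j b.back = a.back ∧ a.back ≠ b.back }⟩
    of := fun {a b} j => ⟨κ j.down.1 b.back, ?_⟩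
    unique_lift := ?_ }⟩
  · have h := hκq j.down.1 b.back
    rw [j.down.2.2.1] at h
    exact h
  · intro X _ f
    let y : J → Q → X := fun j q => if h : rep j q = q ∧ base j q ≠ q then
      @f (objEquiv G Q (base j q)) (objEquiv G Q q) ⟨⟨j, h.1, rfl, h.2⟩⟩ else 1
    have hy : ∀ j q, base j q = q → y j q = 1 := fun j q h => dif_neg fun h' => h'.2 h
    obtain ⟨Ψ, hΨ, hΨy⟩ := hG.exists_hom_of_labels hrep hrep' hbase' hrb hbb y hy
    refine ⟨uncurry Ψ hΨ, ?_, fun E hE => ?_⟩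
    · rintro ⟨⟨⟩, a : Q⟩ ⟨⟨⟩, b : Q⟩ ⟨j, hj1 : rep j b = b, hj2 : base j b = a, hj3 : a ≠ b⟩
      subst hj2
      exact (hΨy j b hj1 _ (hκ j b) (hκq j b)).trans (dif_pos ⟨hj1, hj3⟩)
    · have : curry E = Ψ := by
        refine hG.hom_ext_of_arrows hrep hrep' (fun j q => ⟨κ j q, hκ j q, hκq j q⟩) hbase'
          (fun g => rfl) hΨ fun j q hq k hk hkq => ?_
        rw [hΨy j q hq k hk hkq]
        by_cases hb : base j q = q
        · rw [hb] at hkq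
          rw [hfree j k hk q hkq, hy j q hb, map_one]
          rfl
        -- By freeness only one element of `K j` carries `base j q` to `q`.
        · have hk' : k = κ j q := by
            refine inv_mul_eq_one.mp
              (hfree j _ ((K j).mul_mem ((K j).inv_mem hk) (hκ j q)) (base j q) ?_)
            rw [mul_smul, hκq, inv_smul_eq_iff, hkq]
          rw [hk']
          refine (curry_left_eq_map E _).symm.trans ((hE (objEquiv G Q (base j q)) (objEquiv G Q q)
            ⟨⟨j, hq, rfl, hb⟩⟩).trans ?_)
          have hyq : y j q = @f (objEquiv G Q (base j q)) (objEquiv G Q q) ⟨⟨j, hq, rfl, hb⟩⟩ :=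
            dif_pos ⟨hq, hb⟩
          exact hyq.symm
      apply Functor.hext
      · intro
        apply Unit.ext
      · refine ActionCategory.cases ?_
        intros
        exact heq_of_eq (by subst this; rfl)

/-- A subgroup of an amalgam which acts freely is free. -/
theorem isFreeGroup_subgroup (hG : IsStarAmalgam root K N) (M : Subgroup G)
    (hfree : ∀ j, ∀ k ∈ K j, ∀ q : G ⧸ M, k • q = q → k = 1) : IsFreeGroup M := by
  obtain ⟨h⟩ := hG.exists_isFreeGroupoid hfree
  have hconn : IsConnected (ActionCategory G (G ⧸ M)) := inferInstance
  exact @IsFreeGroupoid.isFreeGroup_of_end_mulEquiv _ _ hconn h _ _ _ (endMulEquivSubgroup M)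

end IsStarAmalgam
end FreeSubgroup

/-! ### Free permutation representations and normal `p'`-subgroups -/

section PermutationRepresentation

/-- Choosing a point in each orbit identifies that orbit with the regular `N`-set. -/
theorem MulAction.exists_orbits_prod_equiv {N X : Type*} [Group N] [MulAction N X]
    (hX : ∀ (n : N) (x : X), n • x = x → n = 1) :
    ∃ e : MulAction.orbitRel.Quotient N X × N ≃ X, ∀ o m n, e (o, m * n) = m • e (o, n) := by
  refine ⟨Equiv.ofBijective (fun a => a.2 • Quotient.out a.1) ⟨?_, fun x => ?_⟩,
    fun o m n => mul_smul _ _ _⟩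
  · rintro ⟨o, n⟩ ⟨o', n'⟩ (h : n • Quotient.out o = n' • Quotient.out o')
    have ho : o = o' := by
      rw [← Quotient.out_eq o, ← Quotient.out_eq o']
      refine Quotient.sound (s := MulAction.orbitRel N X) ⟨n⁻¹ * n', ?_⟩
      change (n⁻¹ * n') • Quotient.out o' = _
      rw [mul_smul, ← h, inv_smul_smul]
    subst ho
    have hn : n⁻¹ * n' = 1 := hX _ (Quotient.out o) (by rw [mul_smul, ← h, inv_smul_smul])
    rw [inv_mul_eq_one.mp hn]
  · obtain ⟨n, hn⟩ := (MulAction.orbitRel N X).symm (Quotient.mk_out x)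
    exact ⟨(Quotient.mk _ x, n), hn⟩

/-- Two free actions of a finite group on finite sets of the same size are isomorphic. -/
theorem MulAction.exists_equivariant_equiv {N X Y : Type*} [Group N] [Finite N] [Finite X]
    [Finite Y] [MulAction N X] [MulAction N Y] (hX : ∀ (n : N) (x : X), n • x = x → n = 1)
    (hY : ∀ (n : N) (y : Y), n • y = y → n = 1) (hcard : Nat.card X = Nat.card Y) :
    ∃ e : X ≃ Y, ∀ (n : N) x, e (n • x) = n • e x := by
  obtain ⟨e, he⟩ := MulAction.exists_orbits_prod_equiv hX
  obtain ⟨f, hf⟩ := MulAction.exists_orbits_prod_equiv hY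
  rw [← Nat.card_congr e, ← Nat.card_congr f, Nat.card_prod, Nat.card_prod] at hcard
  have : Finite (MulAction.orbitRel.Quotient N X) := Quotient.finite _
  have : Finite (MulAction.orbitRel.Quotient N Y) := Quotient.finite _
  obtain ⟨g⟩ := Finite.card_eq.mp (Nat.eq_of_mul_eq_mul_right Nat.card_pos hcard)
  refine ⟨e.symm.trans ((g.prodCongr (Equiv.refl N)).trans f), fun n x => ?_⟩
  obtain ⟨⟨o, m⟩, rfl⟩ := e.surjective x
  rw [← he]
  simp [hf]

/-- Two fixed-point-free permutation representations of a finite group on a finite set are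
conjugate. -/
theorem exists_perm_conj_of_free {N Ω : Type*} [Group N] [Finite N] [Finite Ω]
    (α β : N →* Equiv.Perm Ω) (hα : ∀ n x, α n x = x → n = 1) (hβ : ∀ n x, β n x = x → n = 1) :
    ∃ σ : Equiv.Perm Ω, ∀ n, MulAut.conj σ (α n) = β n := by
  obtain ⟨σ, hσ⟩ := @MulAction.exists_equivariant_equiv N Ω Ω _ _ _ _
    (MulAction.compHom Ω α) (MulAction.compHom Ω β) hα hβ rfl
  refine ⟨σ, fun n => Equiv.ext fun x => ?_⟩
  have h : σ (α n (σ.symm x)) = β n (σ (σ.symm x)) := hσ n (σ.symm x)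
  rw [Equiv.apply_symm_apply] at h
  exact h

/-- The permutation representation of `K` on several copies of `K ⧸ H`. -/
theorem Subgroup.exists_permHom {K : Type*} [Group K] (H : Subgroup K) {t : ℕ} (ht : t ≠ 0)
    (hH : H.index ∣ t) :
    ∃ α : K →* Equiv.Perm (Fin t), α.ker = H.normalCore ∧
      ∀ k x, α k x = x → ∃ g, g⁻¹ * k * g ∈ H := by
  obtain ⟨c, rfl⟩ := hH
  have hi : H.index ≠ 0 := left_ne_zero_of_mul ht
  have : NeZero c := ⟨right_ne_zero_of_mul ht⟩
  have : H.FiniteIndex := ⟨hi⟩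
  have hcard : Nat.card ((K ⧸ H) × Fin c) = Nat.card (Fin (H.index * c)) := by
    simp [Subgroup.index]
  obtain ⟨e⟩ := Finite.card_eq.mp hcard
  let α : K →* Equiv.Perm (Fin (H.index * c)) :=
    { toFun k := e.permCongr ((MulAction.toPerm k).prodCongr (Equiv.refl _))
      map_one' := by
        refine Equiv.ext fun x => ?_
        obtain ⟨⟨x, y⟩, rfl⟩ := e.surjective x
        simp
      map_mul' k l := by
        refine Equiv.ext fun x => ?_
        obtain ⟨⟨x, y⟩, rfl⟩ := e.surjective x
        simp [mul_smul] }
  have hα : ∀ k x y, α k (e (x, y)) = e (k • x, y) := fun k x y => by simp [α]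
  refine ⟨α, ?_, fun k x hx => ?_⟩
  · rw [Subgroup.normalCore_eq_ker]
    ext k
    simp only [MonoidHom.mem_ker, Equiv.ext_iff, MulAction.toPermHom_apply]
    refine ⟨fun h x => ?_, fun h x => ?_⟩
    · have := h (e (x, 0))
      rw [hα] at this
      exact congrArg Prod.fst (e.injective this)
    · obtain ⟨⟨x, y⟩, rfl⟩ := e.surjective x
      rw [hα]
      exact congrArg (fun z => e (z, y)) (h x)
  · obtain ⟨⟨x, y⟩, rfl⟩ := e.surjective x
    rw [hα] at hx
    have h := congrArg Prod.fst (e.injective hx)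
    induction x using QuotientGroup.induction_on with | H g => ?_
    have h' := QuotientGroup.eq.mp (h : ((k * g : K) : K ⧸ H) = (g : K ⧸ H)).symm
    exact ⟨g, by rwa [mul_assoc]⟩

theorem eq_one_of_mem_of_pow_eq_one {p : ℕ} {K : Type*} [Group K] {H : Subgroup K}
    (hH : (Nat.card H).Coprime p) {k : K} (hk : k ∈ H) {n : ℕ} (hn : k ^ p ^ n = 1) : k = 1 := by
  rw [← orderOf_eq_one_iff]
  have h1 : orderOf k ∣ Nat.card H := Subgroup.orderOf_dvd_natCard H hk
  exact Nat.eq_one_of_dvd_coprimes (hH.pow_right n) h1 (orderOf_dvd_of_pow_eq_one hn)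

/-- A normal `p'`-subgroup of a group `K` between `O` and `L` is trivial if the `p`-subgroup `O`
is normal and contains its centralizer. -/
theorem eq_bot_of_normal_of_coprime {p : ℕ} {L : Type*} [Group L] {O : Subgroup L}
    [O.Normal] (hO : IsPGroup p O) (hC : Subgroup.centralizer (O : Set L) ≤ O) {K : Subgroup L}
    (hOK : O ≤ K) (C : Subgroup K) [hCn : C.Normal] (hcard : (Nat.card C).Coprime p) :
    C = ⊥ := by
  -- `C ∩ O = 1` by coprimality. Both are normalized by the other, so `[O, C] ≤ C ∩ O` is trivial
  -- and `C` centralizes `O`.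
  have key : ∀ c ∈ C, (c : L) ∈ O → c = 1 := by
    intro c hc hcO
    obtain ⟨n, hn⟩ := hO ⟨c, hcO⟩
    exact eq_one_of_mem_of_pow_eq_one hcard hc (n := n)
      (Subtype.ext (by simpa using congrArg Subtype.val hn))
  refine (Subgroup.eq_bot_iff_forall _).mpr fun c hc => key c hc (hC ?_)
  refine Subgroup.mem_centralizer_iff.mpr fun x hx => ?_
  have h1 : (⟨x, hOK hx⟩ : K) * c * ⟨x, hOK hx⟩⁻¹ * c⁻¹ = 1 := by
    refine key _ (C.mul_mem (hCn.conj_mem c hc _) (C.inv_mem hc)) ?_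
    have : x * (c * x⁻¹ * (c : L)⁻¹) ∈ O :=
      O.mul_mem hx (Subgroup.Normal.conj_mem inferInstance _ (O.inv_mem hx) _)
    simpa [mul_assoc] using this
  rw [mul_inv_eq_one, mul_inv_eq_iff_eq_mul] at h1
  exact congrArg Subtype.val h1

end PermutationRepresentation

/-! ### Gluing representations over the amalgam -/

section Amalgam

variable {S : Type u} [Group S] {r : ℕ} {P : Fin (r + 1) → Subgroup S}
  {L : Fin (r + 1) → Type v} [∀ i, Group (L i)]
  {ι : ∀ i, Subgroup.normalizer (P i : Set S) →* L i}
  {m : Fin (r + 1) → ℕ} {K : ∀ i, Fin (m i + 1) → Subgroup (L i)}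

namespace Amalgam

variable (h0 : P 0 = ⊤) (hK : ∀ i k, (ι i).range ≤ K i k)

/-- The canonical map from a vertex group to the amalgam. -/
def of (j : (i : Fin (r + 1)) × Fin (m i + 1)) : K j.1 j.2 →* Amalgam h0 hK :=
  (QuotientGroup.mk' _).comp
    (Monoid.CoprodI.of (M := fun j : (i : Fin (r + 1)) × Fin (m i + 1) => K j.1 j.2) (i := j))

theorem of_vertexHom (i : Fin (r + 1)) (k : Fin (m i + 1))
    (u : Subgroup.normalizer (P i : Set S)) :
    of h0 hK ⟨i, k⟩ (vertexHom hK i k u) = of h0 hK ⟨0, 0⟩ (rootHom h0 hK u) := by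
  rw [← mul_inv_eq_one, ← map_inv]
  exact (QuotientGroup.eq_one_iff _).mpr (Subgroup.subset_normalClosure ⟨i, k, u, by simp⟩)

theorem iSup_range_of : ⨆ j, (of h0 hK j).range = ⊤ := by
  refine (Subgroup.eq_top_iff' _).mpr fun x => ?_
  induction x using QuotientGroup.induction_on with | H w => ?_
  induction w using Monoid.CoprodI.induction_on with
  | one => exact Subgroup.one_mem _
  | of j x => exact Subgroup.mem_iSup_of_mem j ⟨x, rfl⟩
  | mul x y hx hy => exact Subgroup.mul_mem _ hx hy

theorem exists_lift {X : Type*} [Group X]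
    (ψ : ∀ j : (i : Fin (r + 1)) × Fin (m i + 1), K j.1 j.2 →* X)
    (h : ∀ i k u, ψ ⟨i, k⟩ (vertexHom hK i k u) = ψ ⟨0, 0⟩ (rootHom h0 hK u)) :
    ∃ Ψ : Amalgam h0 hK →* X, ∀ j x, Ψ (of h0 hK j x) = ψ j x := by
  refine ⟨QuotientGroup.lift _ (Monoid.CoprodI.lift ψ) ?_, fun j x => ?_⟩
  · intro w hw
    refine Subgroup.normalClosure_le_normal (N := (Monoid.CoprodI.lift ψ).ker) ?_ hw
    rintro _ ⟨i, k, u, rfl⟩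
    refine MonoidHom.mem_ker.mpr ?_
    rw [map_mul, map_inv, Monoid.CoprodI.lift_of, Monoid.CoprodI.lift_of, h, mul_inv_cancel]
  · exact Monoid.CoprodI.lift_of ψ x

theorem vertexHom_zero (u : Subgroup.normalizer (P 0 : Set S)) :
    vertexHom hK 0 0 u = rootHom h0 hK u := rfl

/-- The relators at the root index are trivial, so its edge group may be replaced by `⊥`. Then every
point is its own root representative. -/
theorem isStarAmalgam [DecidableEq ((i : Fin (r + 1)) × Fin (m i + 1))] :
    IsStarAmalgam (⟨0, 0⟩ : (i : Fin (r + 1)) × Fin (m i + 1)) (fun j => (of h0 hK j).range)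
      fun j => if j = ⟨0, 0⟩ then ⊥ else ((of h0 hK j).comp (vertexHom hK j.1 j.2)).range where
  le j := by
    split_ifs
    · exact bot_le
    · rintro _ ⟨u, rfl⟩
      exact ⟨_, rfl⟩
  le_root j := by
    split_ifs
    · exact bot_le
    · rintro _ ⟨u, rfl⟩
      exact ⟨_, (of_vertexHom h0 hK j.1 j.2 u).symm⟩
  root_eq_bot := if_pos rfl
  iSup_eq_top := iSup_range_of h0 hK
  lift := by
    intro X _ ψ hψ
    obtain ⟨Ψ, hΨ⟩ := exists_lift h0 hK (fun j => (ψ j).comp (of h0 hK j).rangeRestrict) (by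
      intro i k u
      by_cases hj : (⟨i, k⟩ : (i : Fin (r + 1)) × Fin (m i + 1)) = ⟨0, 0⟩
      · cases hj
        rfl
      · have h1 := hψ ⟨i, k⟩ (of h0 hK ⟨i, k⟩ (vertexHom hK i k u))
          (by rw [if_neg hj]; exact ⟨u, rfl⟩)
        refine h1.trans (congrArg (ψ ⟨0, 0⟩) (Subtype.ext (of_vertexHom h0 hK i k u))))
    refine ⟨Ψ, fun j x => ?_⟩
    obtain ⟨_, x, rfl⟩ := x
    exact hΨ j x

/-- Faithful representations of the vertex groups on which the amalgamated `p`-group acts freely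
can be glued. -/
theorem exists_permHom_injective [Finite S] {Ω : Type*} [Finite Ω]
    (α : ∀ j : (i : Fin (r + 1)) × Fin (m i + 1), K j.1 j.2 →* Equiv.Perm Ω)
    (hα : ∀ j, Function.Injective (α j))
    (hfree : ∀ i k u x, α ⟨i, k⟩ (vertexHom hK i k u) x = x → u = 1) :
    ∃ φ : Amalgam h0 hK →* Equiv.Perm Ω, ∀ j, Function.Injective (φ.comp (of h0 hK j)) := by
  -- The root action is the common target of the conjugations, so it must itself stay fixed: `σ = 1`
  -- there.
  have hex : ∀ j : (i : Fin (r + 1)) × Fin (m i + 1), ∃ σ : Equiv.Perm Ω,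
      (∀ u, MulAut.conj σ (α j (vertexHom hK j.1 j.2 u)) = α ⟨0, 0⟩ (rootHom h0 hK u)) ∧
        (j = ⟨0, 0⟩ → σ = 1) := by
    intro j
    by_cases hj : j = ⟨0, 0⟩
    · subst hj
      exact ⟨1, fun u => by rw [map_one, ← vertexHom_zero h0 hK u]; rfl, fun _ => rfl⟩
    · obtain ⟨σ, hσ⟩ := exists_perm_conj_of_free ((α j).comp (vertexHom hK j.1 j.2))
        ((α ⟨0, 0⟩).comp ((rootHom h0 hK).comp (Subgroup.subtype _))) (hfree j.1 j.2) (by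
          intro u x hx
          have hu : (u : S) ∈ Subgroup.normalizer (P 0 : Set S) := by
            have : (P 0).Normal := by rw [h0]; infer_instance
            rw [Subgroup.normalizer_eq_top]
            exact Subgroup.mem_top _
          have h1 := hfree 0 0 ⟨u, hu⟩ x hx
          exact Subtype.ext (by simpa using congrArg Subtype.val h1))
      exact ⟨σ, hσ, fun h => absurd h hj⟩
  choose σ hσ hσ1 using hex
  obtain ⟨φ, hφ⟩ := exists_lift h0 hK (fun j => (MulAut.conj (σ j)).toMonoidHom.comp (α j)) (by
    intro i k u
    refine (hσ ⟨i, k⟩ u).trans ?_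
    change _ = MulAut.conj (σ ⟨0, 0⟩) (α ⟨0, 0⟩ (rootHom h0 hK u))
    rw [hσ1 ⟨0, 0⟩ rfl, map_one]
    rfl)
  refine ⟨φ, fun j => ?_⟩
  have : φ.comp (of h0 hK j) = (MulAut.conj (σ j)).toMonoidHom.comp (α j) :=
    MonoidHom.ext (hφ j)
  rw [this]
  exact (MulAut.conj (σ j)).injective.comp (hα j)

/-- An element of a vertex group fixing a coset of the normal subgroup `φ.ker` lies in `φ.ker`,
hence is trivial. -/
theorem isFreeGroup_ker {X : Type*} [Group X] (φ : Amalgam h0 hK →* X)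
    (hφ : ∀ j, Function.Injective (φ.comp (of h0 hK j))) : IsFreeGroup φ.ker := by
  classical
  refine (isStarAmalgam h0 hK).isFreeGroup_subgroup φ.ker ?_
  rintro j _ ⟨x, rfl⟩ q hq
  induction q using QuotientGroup.induction_on with | H g => ?_
  have h1 := QuotientGroup.eq.mp (hq : ((of h0 hK j x * g : Amalgam h0 hK) : _ ⧸ φ.ker) = g).symm
  replace h1 : φ (g⁻¹ * (of h0 hK j x * g)) = 1 := h1
  rw [map_mul, map_mul, map_inv, inv_mul_eq_one] at h1
  have h2 : x = 1 := hφ j ((mul_eq_right.mp h1.symm).trans (map_one _).symm)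
  rw [h2, map_one]

end Amalgam
end Amalgam

/-! ### The main theorem -/

theorem mainTheorem9 {p : ℕ} (hp : p.Prime) {S : Type u} [Group S] [Finite S]
    (hS : IsPGroup p S) (F : FusionSystem S) {r : ℕ} {P : Fin (r + 1) → Subgroup S}
    {L : Fin (r + 1) → Type v} [∀ i, Group (L i)]
    {ι : ∀ i, Subgroup.normalizer (P i : Set S) →* L i}
    (hF : IsAlperinFamily p F P L ι)
    {m : Fin (r + 1) → ℕ} (K : ∀ i, Fin (m i + 1) → Subgroup (L i))
    (hK : ∀ i k, (ι i).range ≤ K i k) (hgen : ∀ i, ⨆ k, K i k = ⊤)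
    (H : ∀ i k, Subgroup (K i k)) (hH : ∀ i k, (Nat.card (H i k)).Coprime p)
    (t : ℕ)
    (ht : t = Finset.univ.lcm fun j : (i : Fin (r + 1)) × Fin (m i + 1) => (H j.1 j.2).index) :
    (∃ φ : Amalgam hF.P_zero hK →* Equiv.Perm (Fin t), IsFreeGroup φ.ker) ∧
      ∃ N : Subgroup (Amalgam hF.P_zero hK), N.FiniteIndex ∧ IsFreeGroup N := by
  have := hF.finite
  have hind : ∀ i k, (H i k).index ≠ 0 := fun i k => Subgroup.FiniteIndex.index_ne_zero
  have ht0 : t ≠ 0 := by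
    rw [ht, Ne, Finset.lcm_eq_zero_iff]
    rintro ⟨j, -, hj⟩
    exact hind _ _ hj
  have hex : ∀ j : (i : Fin (r + 1)) × Fin (m i + 1), ∃ α : K j.1 j.2 →* Equiv.Perm (Fin t),
      α.ker = (H j.1 j.2).normalCore ∧ ∀ k x, α k x = x → ∃ g, g⁻¹ * k * g ∈ H j.1 j.2 :=
    fun j => (H j.1 j.2).exists_permHom ht0 (ht ▸ Finset.dvd_lcm (Finset.mem_univ j))
  choose α hα hα' using hex
  suffices h : ∃ φ : Amalgam hF.P_zero hK →* Equiv.Perm (Fin t),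
      ∀ j, Function.Injective (φ.comp (Amalgam.of hF.P_zero hK j)) by
    obtain ⟨φ, hφ⟩ := h
    have hfree := Amalgam.isFreeGroup_ker hF.P_zero hK φ hφ
    exact ⟨⟨φ, hfree⟩, φ.ker, inferInstance, hfree⟩
  refine Amalgam.exists_permHom_injective hF.P_zero hK α (fun j => ?_) fun i k u x hx => ?_
  · rw [← MonoidHom.ker_eq_bot_iff, hα]
    have hO : IsPGroup p (opRadical p (L j.1)) := by
      rw [← hF.radical]
      exact ((hS.to_subgroup _).to_subgroup _).map _
    refine eq_bot_of_normal_of_coprime hO ?_ ?_ _ ?_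
    · rw [hF.centric]
      exact Subgroup.map_subtype_le _
    · rw [← hF.radical]
      exact (Subgroup.map_le_range _ _).trans (hK j.1 j.2)
    · exact (hH j.1 j.2).coprime_dvd_left (Subgroup.card_dvd_of_le (Subgroup.normalCore_le _))
  -- A `p`-element with a fixed point is conjugate into the `p'`-group `H i k`, so it is trivial.
  · obtain ⟨g, hg⟩ := hα' ⟨i, k⟩ _ x hx
    obtain ⟨n, hn⟩ := hS u
    have h1 : g⁻¹ * vertexHom hK i k u * g = 1 := by
      refine eq_one_of_mem_of_pow_eq_one (hH i k) hg (n := n) ?_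
      have h2 : u ^ p ^ n = 1 := Subtype.ext (by simpa using hn)
      have h3 := conj_pow (i := p ^ n) (a := g⁻¹) (b := vertexHom hK i k u)
      rw [inv_inv] at h3
      rw [h3, ← map_pow, h2]
      simp
    have h2 : vertexHom hK i k u = 1 := by
      rw [mul_assoc, inv_mul_eq_one] at h1
      exact (mul_eq_right.mp h1.symm)
    have h3 : ι i u = 1 := congrArg Subtype.val h2
    exact (map_eq_one_iff _ (hF.ι_injective i)).mp h3
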